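/- Let $H$ be a real Hilbert space and let $C\subseteq H$ be closed and convex. Let $f:C\to C$ be a contraction with constant $\alpha\in(0,1)$, that is, $\|f(x)-f(y)\|\le\alpha\|x-y\|$ for all $x,y\in C$. Let $A:H\to H$ be a bounded linear operator that is strongly positive with coefficient $\bar\gamma>0$, that is, $\langle Ax,x\rangle\ge\bar\gamma\|x\|^2$ for all $x\in H$. Let $0<\gamma<\bar\gamma/\alpha$. Let $T_i:C\to C$ ($i\ge1$) be nonexpansive mappings, that is, $\|T_ix-T_iy\|\le\|x-y\|$ for all $x,y\in C$, with $F:=\bigcap_{i\ge1}\{p\in C: T_ip=p\}\neq\emptyset$. Let $(\theta_i)_{i\ge1}$ be real numbers with $0<\theta_i\le b<1$ for all $i\ge1$ and some constant $b$. For $n\ge0$ define mappings $U_{n,k}:C\to C$ by $U_{n,n+1}=I$ and $$U_{n,k}=\theta_kT_kU_{n,k+1}+(1-\theta_k)I\qquad(k=n,n-1,\dots,1),$$ and put $W_n=U_{n,1}$ (the Shimoji–Takahashi $W_n$-mapping; $W_0=I$). Let $(\alpha_n)_{n\ge0},(\beta_n)_{n\ge0},(\gamma_n)_{n\ge0},(\delta_n)_{n\ge0}$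 be sequences in $[0,1]$ such that - (C1) $\lim_{n\to\infty}\alpha_n=0$ and $\sum_{n=1}^\infty\alpha_n=\infty$; - (C2) $0<\liminf_{n\to\infty}\delta_n\le\limsup_{n\to\infty}\delta_n<1$; - (C3) $\sum_{n=1}^\infty|\gamma_n-\gamma_{n-1}|<\infty$; - (C4) $\sum_{n=1}^\infty|\alpha_n-\alpha_{n-1}|<\infty$; - (C5) $\sum_{n=1}^\infty|\beta_n-\beta_{n-1}|<\infty$; - (C6) there is $d\in(0,1)$ with $(1+\beta_n)\gamma_n-2\beta_n>d$ for all $n\ge0$. Let $x_0\in C$ be arbitrary and, for $n\ge0$, let $$z_n=\gamma_nx_n+(1-\gamma_n)W_nx_n,\qquad y_n=\beta_nx_n+(1-\beta_n)W_nz_n,$$ $$x_{n+1}=P_C\bigl[\alpha_n\gamma f(x_n)+\delta_nx_n+((1-\delta_n)I-\alpha_nA)y_n\bigr],$$ where $P_C$ is the metric (nearest point) projection of $H$ onto $C$. Then there is exactly one $q\in F$ with $\langle\gamma f(q)-Aq,\,p-q\rangle\le0$ for all $p\in F$, and $(x_n)$ converges strongly to this $q$. -/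

import Mathlib

open Filter Topology

/-- The metric (nearest point) projection onto `C`: a point of `C` at minimal distance from `u`.
For nonempty closed convex `C` in a Hilbert space this point exists and is unique (see
`metricProj_mem`, `metricProj_le`, `eq_metricProj` below). If no nearest point exists, the value
is `u`, by convention. -/
noncomputable def metricProj {H : Type*} [NormedAddCommGroup H] (C : Set H) (u : H) : H :=
  open Classical in
  if h : ∃ p ∈ C, ∀ w ∈ C, ‖u - p‖ ≤ ‖u - w‖ then h.choose else u

/-- The maps of Shimoji and Takahashi, counted by the number `m` of maps that are composed:
starting from the identity (`m = 0`),
`x ↦ θ_k T_k (shimojiAux m (k+1) x) + (1 - θ_k) x`. -/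
def shimojiAux {H : Type*} [AddCommGroup H] [Module ℝ H]
    (T : ℕ → H → H) (θ : ℕ → ℝ) : ℕ → ℕ → H → H
  | 0, _, x => x
  | m + 1, k, x => θ k • T k (shimojiAux T θ m (k + 1) x) + (1 - θ k) • x

/-- `U_{n,k}`, for `1 ≤ k ≤ n + 1`: one has `U_{n,n+1} = I` and
`U_{n,k} = θ_k T_k U_{n,k+1} + (1 - θ_k) I` for `k ≤ n`
(see `shimojiU_top` and `shimojiU_of_le`). -/
def shimojiU {H : Type*} [AddCommGroup H] [Module ℝ H]
    (T : ℕ → H → H) (θ : ℕ → ℝ) (n k : ℕ) : H → H :=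
  shimojiAux T θ (n + 1 - k) k

/-- The `W_n`-mapping `W_n = U_{n,1}` generated by `T_1, …, T_n` and `θ_1, …, θ_n`;
in particular `W_0 = I`. -/
def shimojiW {H : Type*} [AddCommGroup H] [Module ℝ H]
    (T : ℕ → H → H) (θ : ℕ → ℝ) (n : ℕ) : H → H :=
  shimojiU T θ n 1

/-- The set `F = ⋂_{i ≥ 1} F(T_i)` of common fixed points in `C`. -/
def commonFixedPoints {H : Type*} (C : Set H) (T : ℕ → H → H) : Set H :=
  {p | p ∈ C ∧ ∀ i, 1 ≤ i → T i p = p}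

theorem shimojiU_top {H : Type*} [AddCommGroup H] [Module ℝ H]
    (T : ℕ → H → H) (θ : ℕ → ℝ) (n : ℕ) (x : H) : shimojiU T θ n (n + 1) x = x := by
  simp [shimojiU, shimojiAux]

theorem shimojiU_of_le {H : Type*} [AddCommGroup H] [Module ℝ H]
    (T : ℕ → H → H) (θ : ℕ → ℝ) {n k : ℕ} (hk : k ≤ n) (x : H) :
    shimojiU T θ n k x = θ k • T k (shimojiU T θ n (k + 1) x) + (1 - θ k) • x := by
  have h : n + 1 - k = (n + 1 - (k + 1)) + 1 := by omega
  unfold shimojiU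
  rw [h, shimojiAux]

theorem exists_nearest {H : Type*} [NormedAddCommGroup H] [InnerProductSpace ℝ H]
    [CompleteSpace H] {C : Set H} (hne : C.Nonempty) (hcl : IsClosed C) (hcv : Convex ℝ C)
    (u : H) : ∃ p ∈ C, ∀ w ∈ C, ‖u - p‖ ≤ ‖u - w‖ := by
  obtain ⟨p, hp, hmin⟩ := exists_norm_eq_iInf_of_complete_convex hne hcl.isComplete hcv u
  refine ⟨p, hp, fun w hw => ?_⟩
  rw [hmin]
  exact ciInf_le ⟨0, by rintro _ ⟨a, rfl⟩; exact norm_nonneg _⟩ (⟨w, hw⟩ : C)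

theorem metricProj_mem {H : Type*} [NormedAddCommGroup H] [InnerProductSpace ℝ H]
    [CompleteSpace H] {C : Set H} (hne : C.Nonempty) (hcl : IsClosed C) (hcv : Convex ℝ C)
    (u : H) : metricProj C u ∈ C := by
  have h := exists_nearest hne hcl hcv u
  rw [metricProj, dif_pos h]
  exact h.choose_spec.1

theorem metricProj_le {H : Type*} [NormedAddCommGroup H] [InnerProductSpace ℝ H]
    [CompleteSpace H] {C : Set H} (hne : C.Nonempty) (hcl : IsClosed C) (hcv : Convex ℝ C)
    (u : H) {w : H} (hw : w ∈ C) : ‖u - metricProj C u‖ ≤ ‖u - w‖ := by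
  have h := exists_nearest hne hcl hcv u
  rw [metricProj, dif_pos h]
  exact h.choose_spec.2 w hw

theorem inner_nearest_nonpos {H : Type*} [NormedAddCommGroup H] [InnerProductSpace ℝ H]
    {C : Set H} (hcv : Convex ℝ C) {u p : H} (hp : p ∈ C)
    (hmin : ∀ w ∈ C, ‖u - p‖ ≤ ‖u - w‖) : ∀ w ∈ C, inner ℝ (u - p) (w - p) ≤ 0 := by
  refine (norm_eq_iInf_iff_real_inner_le_zero hcv hp).1 (le_antisymm ?_ ?_)
  · have : Nonempty C := ⟨⟨p, hp⟩⟩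
    exact le_ciInf fun w => hmin w w.2
  · exact ciInf_le ⟨0, by rintro _ ⟨a, rfl⟩; exact norm_nonneg _⟩ (⟨p, hp⟩ : C)

theorem eq_metricProj {H : Type*} [NormedAddCommGroup H] [InnerProductSpace ℝ H]
    [CompleteSpace H] {C : Set H} (hcl : IsClosed C) (hcv : Convex ℝ C)
    {u p : H} (hp : p ∈ C) (hmin : ∀ w ∈ C, ‖u - p‖ ≤ ‖u - w‖) : p = metricProj C u := by
  have hne : C.Nonempty := ⟨p, hp⟩
  have hq := metricProj_mem hne hcl hcv u
  have h1 := inner_nearest_nonpos hcv hp hmin _ hq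
  have h2 := inner_nearest_nonpos hcv hq (fun w hw => metricProj_le hne hcl hcv u hw) _ hp
  generalize metricProj C u = q at h1 h2
  have h3 : inner ℝ (q - p) (q - p) = inner ℝ (u - p) (q - p) + inner ℝ (u - q) (p - q) := by
    have e : p - q = -(q - p) := by abel
    rw [e, inner_neg_right, ← sub_eq_add_neg, ← inner_sub_left]
    congr 1
    abel
  have h4 : ‖q - p‖ ^ 2 ≤ 0 := by
    rw [← real_inner_self_eq_norm_sq, h3]
    linarith
  have h5 : ‖q - p‖ = 0 := pow_eq_zero_iff two_ne_zero |>.1 (le_antisymm h4 (sq_nonneg _))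
  exact (sub_eq_zero.1 (norm_eq_zero.1 h5)).symm

/-! Write `g = γ f`. Since `A - g` is strongly monotone, the variational inequality for `g - A` over
the closed convex set `F` has exactly one solution `q`. Nonexpansiveness of `P_C` and of the maps
`W_n` gives the recursion
`‖x_{n+1} - q‖² ≤ (1 - c α_n) ‖x_n - q‖² + α_n τ_n - δ_n (1 - δ_n) ‖x_n - y_n‖²`, where
`τ_n = 2 ⟨g q - A q, x_n - q⟩ + O(‖x_n - y_n‖ + α_n)`. As `∑ α_n = ∞`, it is enough that, for every
`ε > 0`, eventually `α_n τ_n - δ_n (1 - δ_n) ‖x_n - y_n‖² ≤ α_n ε`. Along an ultrafilter on which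
this fails, `‖x_n - y_n‖² = O(α_n)`, so `W_n x_n - x_n → 0`. Peeling off one map at a time yields
`T_k x_n - x_n → 0` for every `k`, so by demiclosedness the weak limit of `x_n` lies in `F`; by the
choice of `q` the inner product in `τ_n` then has nonpositive limit, a contradiction. -/

theorem exists_eventually_mem_Icc_of_lt_liminf_of_limsup_lt {ι R : Type*}
    [ConditionallyCompleteLinearOrder R] [DenselyOrdered R] {l : Filter ι} {u : ι → R}
    {a b m M : R} (hu : ∀ i, u i ∈ Set.Icc m M) (ha : a < liminf u l) (hb : limsup u l < b) :
    ∃ c₁ > a, ∃ c₂ < b, ∀ᶠ i in l, u i ∈ Set.Icc c₁ c₂ := by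
  obtain ⟨c₁, hac₁, hc₁⟩ := exists_between ha
  obtain ⟨c₂, hc₂, hc₂b⟩ := exists_between hb
  refine ⟨c₁, hac₁, c₂, hc₂b, ?_⟩
  filter_upwards [eventually_lt_of_lt_liminf hc₁ (isBoundedUnder_of ⟨m, fun i => (hu i).1⟩),
    eventually_lt_of_limsup_lt hc₂ (isBoundedUnder_of ⟨M, fun i => (hu i).2⟩)] with i h₁ h₂
  exact ⟨h₁.le, h₂.le⟩

section RealSequences

theorem not_summable_of_tendsto_sum_Icc {a : ℕ → ℝ} {k : ℕ} (ha0 : ∀ n, 0 ≤ a n)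
    (ha : Tendsto (fun N => ∑ n ∈ Finset.Icc k N, a n) atTop atTop) : ¬Summable a := fun hsum => by
  obtain ⟨N, hN⟩ := (ha.eventually_gt_atTop (∑' n, a n)).exists
  exact hN.not_ge (hsum.sum_le_tsum _ fun n _ => ha0 n)

theorem bddAbove_range_of_le_convexComb {s a : ℕ → ℝ} {B : ℝ}
    (ha : ∀ᶠ n in atTop, a n ∈ Set.Icc 0 1)
    (hs : ∀ᶠ n in atTop, s (n + 1) ≤ (1 - a n) * s n + a n * B) : BddAbove (Set.range s) := by
  obtain ⟨N, hN⟩ := eventually_atTop.1 (ha.and hs)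
  have hmax : ∀ n ≥ N, s n ≤ max (s N) B := by
    intro n hn
    induction n, hn using Nat.le_induction with
    | base => exact le_max_left _ _
    | succ n hn ih =>
      obtain ⟨⟨ha0, ha1⟩, hsn⟩ := hN n hn
      calc s (n + 1) ≤ (1 - a n) * s n + a n * B := hsn
        _ ≤ (1 - a n) * max (s N) B + a n * max (s N) B := by
          have := sub_nonneg.2 ha1
          gcongr
          exact le_max_right _ _
        _ = max (s N) B := by ring
  exact IsBoundedUnder.bddAbove_range ⟨_, eventually_map.2 (eventually_atTop.2 ⟨N, hmax⟩)⟩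

theorem tendsto_zero_of_le_one_sub_mul {s a : ℕ → ℝ} (hs0 : ∀ n, 0 ≤ s n) (ha0 : ∀ n, 0 ≤ a n)
    (ha : ¬Summable a) (hs : ∀ᶠ n in atTop, s (n + 1) ≤ (1 - a n) * s n) :
    Tendsto s atTop (𝓝 0) := by
  obtain ⟨N, hN⟩ := eventually_atTop.1 hs
  set S : ℕ → ℝ := fun n => ∑ k ∈ Finset.range n, a k
  have hexp : ∀ n ≥ N, s n ≤ Real.exp (-S n) * (Real.exp (S N) * s N) := by
    intro n hn
    induction n, hn using Nat.le_induction with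
    | base => rw [← mul_assoc, ← Real.exp_add, neg_add_cancel, Real.exp_zero, one_mul]
    | succ n hn ih =>
      calc s (n + 1) ≤ (1 - a n) * s n := hN n hn
        _ ≤ Real.exp (-a n) * (Real.exp (-S n) * (Real.exp (S N) * s N)) :=
          mul_le_mul (Real.one_sub_le_exp_neg _) ih (hs0 n) (Real.exp_pos _).le
        _ = Real.exp (-S (n + 1)) * (Real.exp (S N) * s N) := by
          rw [← mul_assoc, ← Real.exp_add, ← neg_add, add_comm (a n), ← Finset.sum_range_succ]
  have hS : Tendsto S atTop atTop := (not_summable_iff_tendsto_nat_atTop_of_nonneg ha0).1 ha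
  refine squeeze_zero' (.of_forall hs0) (eventually_atTop.2 ⟨N, hexp⟩) ?_
  simpa using (Real.tendsto_exp_neg_atTop_nhds_zero.comp hS).mul_const (Real.exp (S N) * s N)

theorem tendsto_zero_of_le_one_sub_mul_add {s a : ℕ → ℝ} (hs0 : ∀ n, 0 ≤ s n)
    (ha0 : ∀ n, 0 ≤ a n) (ha1 : ∀ᶠ n in atTop, a n ≤ 1) (ha : ¬Summable a)
    (hs : ∀ ε > 0, ∀ᶠ n in atTop, s (n + 1) ≤ (1 - a n) * s n + a n * ε) :
    Tendsto s atTop (𝓝 0) := by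
  refine tendsto_order.2 ⟨fun r hr => .of_forall fun n => hr.trans_le (hs0 n), fun ε hε => ?_⟩
  have hexcess : Tendsto (fun n => max (s n - ε / 2) 0) atTop (𝓝 0) := by
    refine tendsto_zero_of_le_one_sub_mul (fun n => le_max_right _ _) ha0 ha ?_
    filter_upwards [ha1, hs (ε / 2) (half_pos hε)] with n ha1n hsn
    have hfac : 0 ≤ 1 - a n := sub_nonneg.2 ha1n
    refine max_le ?_ (mul_nonneg hfac (le_max_right _ _))
    calc s (n + 1) - ε / 2 ≤ (1 - a n) * (s n - ε / 2) := by linarith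
      _ ≤ (1 - a n) * max (s n - ε / 2) 0 := by gcongr; exact le_max_left _ _
  filter_upwards [hexcess.eventually_lt_const (half_pos hε)] with n hn
  linarith [le_max_left (s n - ε / 2) 0]

/- If `a n * τ n - η n > a n * ε` held along an ultrafilter, then `η n ≤ a n * B → 0` along it, and
the hypothesis on `τ` would be contradicted. -/
theorem tendsto_zero_of_le_one_sub_mul_add_sub {s a τ η : ℕ → ℝ} {c : ℝ} (hc : 0 < c)
    (hs0 : ∀ n, 0 ≤ s n) (ha0 : ∀ n, 0 ≤ a n) (ha_lim : Tendsto a atTop (𝓝 0))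
    (ha : ¬Summable a) (hη0 : ∀ n, 0 ≤ η n) (hτ : BddAbove (Set.range τ))
    (hτη : ∀ U : Ultrafilter ℕ, (U : Filter ℕ) ≤ atTop → Tendsto η U (𝓝 0) →
      ∀ ε > 0, ∀ᶠ n in U, τ n ≤ ε)
    (hs : ∀ᶠ n in atTop, s (n + 1) ≤ (1 - c * a n) * s n + a n * τ n - η n) :
    Tendsto s atTop (𝓝 0) := by
  have herror : ∀ ε > 0, ∀ᶠ n in atTop, a n * τ n - η n ≤ a n * ε := by
    intro ε hε
    refine mem_iff_ultrafilter.2 fun U hU => ?_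
    by_contra hbad
    have hbad : ∀ᶠ n in U, ¬a n * τ n - η n ≤ a n * ε := Ultrafilter.compl_mem_iff_notMem.2 hbad
    obtain ⟨B, hB⟩ := hτ
    have hη_lim : Tendsto η U (𝓝 0) := by
      refine squeeze_zero' (.of_forall hη0) ?_ (by simpa using (ha_lim.mono_left hU).mul_const B)
      filter_upwards [hbad] with n hn
      have hτB := mul_le_mul_of_nonneg_left (hB (Set.mem_range_self n)) (ha0 n)
      linarith [mul_nonneg (ha0 n) hε.le]
    obtain ⟨n, hn, hτn⟩ := (hbad.and (hτη U hU hη_lim ε hε)).exists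
    exact hn (by linarith [mul_le_mul_of_nonneg_left hτn (ha0 n), hη0 n])
  refine tendsto_zero_of_le_one_sub_mul_add hs0 (fun n => mul_nonneg hc.le (ha0 n)) ?_
    ((summable_mul_left_iff hc.ne').not.2 ha) fun ε hε => ?_
  · exact (by simpa using ha_lim.const_mul c : Tendsto (fun n => c * a n) atTop (𝓝 0)
      ).eventually_le_const one_pos
  · filter_upwards [hs, herror (c * ε) (mul_pos hc hε)] with n hsn hen
    linarith

end RealSequences

theorem isBounded_range_iff_norm_sub_le {ι E : Type*} [SeminormedAddCommGroup E] {x : ι → E}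
    (q : E) : Bornology.IsBounded (Set.range x) ↔ ∃ R, ∀ i, ‖x i - q‖ ≤ R := by
  simp [Metric.isBounded_iff_subset_closedBall q, Set.range_subset_iff, dist_eq_norm]

section WeakTopology

variable {ι E H : Type*} [NormedAddCommGroup E] [NormedSpace ℝ E] [NormedAddCommGroup H]
  [InnerProductSpace ℝ H] {l : Filter ι}

theorem mem_of_tendsto_toWeakSpace [l.NeBot] {C : Set E} (hclosed : IsClosed C)
    (hconvex : Convex ℝ C) {x : ι → E} {p : E} (hx : ∀ᶠ i in l, x i ∈ C)
    (hxp : Tendsto (fun i => toWeakSpace ℝ E (x i)) l (𝓝 (toWeakSpace ℝ E p))) : p ∈ C := by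
  have hweak : IsClosed (toWeakSpace ℝ E '' C) := by
    rw [← closure_eq_iff_isClosed, ← hconvex.toWeakSpace_closure ℝ, hclosed.closure_eq]
  obtain ⟨q, hq, hqp⟩ := hweak.mem_of_tendsto hxp (hx.mono fun _ => Set.mem_image_of_mem _)
  exact (toWeakSpace ℝ E).injective hqp ▸ hq

theorem tendsto_inner_of_tendsto_toWeakSpace {x : ι → H} {p : H}
    (hxp : Tendsto (fun i => toWeakSpace ℝ H (x i)) l (𝓝 (toWeakSpace ℝ H p))) (v : H) :
    Tendsto (fun i => inner ℝ v (x i)) l (𝓝 (inner ℝ v p)) :=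
  ((WeakBilin.eval_continuous (topDualPairing ℝ H).flip (innerSL ℝ v)).tendsto _).comp hxp

theorem isCompact_closure_toWeakSpace_image [CompleteSpace H] {s : Set H}
    (hs : Bornology.IsBounded s) : IsCompact (closure (toWeakSpace ℝ H '' s)) := by
  refine NormedSpace.isCompact_closure_of_isBounded ℝ H _ ?_ ?_
  · rwa [Set.preimage_image_eq _ (toWeakSpace ℝ H).injective]
  · rintro Φ -
    let φ : StrongDual ℝ H := (WeakDual.toStrongDual Φ).comp (innerSL ℝ)
    refine ⟨toWeakSpace ℝ H ((InnerProductSpace.toDual ℝ H).symm φ), ?_⟩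
    refine DFunLike.ext _ _ fun ψ => ?_
    obtain ⟨v, rfl⟩ := (InnerProductSpace.toDual ℝ H).surjective ψ
    calc _ = inner ℝ v ((InnerProductSpace.toDual ℝ H).symm φ) := rfl
      _ = φ v := by rw [real_inner_comm, InnerProductSpace.toDual_symm_apply]
      _ = _ := rfl

theorem exists_tendsto_toWeakSpace_of_isBounded [CompleteSpace H] (U : Ultrafilter ι) {x : ι → H}
    (hx : Bornology.IsBounded (Set.range x)) :
    ∃ p, Tendsto (fun i => toWeakSpace ℝ H (x i)) U (𝓝 (toWeakSpace ℝ H p)) := by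
  have hmem : ∀ i, toWeakSpace ℝ H (x i) ∈ closure (toWeakSpace ℝ H '' Set.range x) :=
    fun i => subset_closure (Set.mem_image_of_mem _ (Set.mem_range_self i))
  obtain ⟨p, -, hp⟩ := (isCompact_closure_toWeakSpace_image hx).ultrafilter_le_nhds
    (U.map fun i => toWeakSpace ℝ H (x i)) (le_principal_iff.2 (mem_map.2 (univ_mem' hmem)))
  exact ⟨(toWeakSpace ℝ H).symm p, by simpa using! hp⟩

theorem eventually_inner_sub_lt_of_tendsto_toWeakSpace [CompleteSpace H] (U : Ultrafilter ι)
    {x : ι → H} (hx : Bornology.IsBounded (Set.range x)) {v q : H}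
    (hv : ∀ p, Tendsto (fun i => toWeakSpace ℝ H (x i)) U (𝓝 (toWeakSpace ℝ H p)) →
      inner ℝ v (p - q) ≤ 0) {ε : ℝ} (hε : 0 < ε) : ∀ᶠ i in U, inner ℝ v (x i - q) < ε := by
  obtain ⟨p, hp⟩ := exists_tendsto_toWeakSpace_of_isBounded U hx
  have hlim := (tendsto_inner_of_tendsto_toWeakSpace hp v).sub_const (inner ℝ v q)
  simp only [← inner_sub_right] at hlim
  exact hlim.eventually_lt_const ((hv p hp).trans_lt hε)

/- Demiclosedness: expand `‖x i - T p‖ ^ 2 ≤ (‖x i - T (x i)‖ + ‖x i - p‖) ^ 2` around `p`; the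
terms `‖x i - p‖ ^ 2` cancel. -/
theorem eq_of_tendsto_toWeakSpace_of_tendsto_sub [l.NeBot] {C : Set H} {T : H → H}
    (hT : LipschitzOnWith 1 T C) {x : ι → H} (hxC : ∀ i, x i ∈ C) {p : H} (hp : p ∈ C)
    (hbdd : Bornology.IsBounded (Set.range x))
    (hxp : Tendsto (fun i => toWeakSpace ℝ H (x i)) l (𝓝 (toWeakSpace ℝ H p)))
    (hTx : Tendsto (fun i => T (x i) - x i) l (𝓝 0)) : T p = p := by
  obtain ⟨R, hR⟩ := (isBounded_range_iff_norm_sub_le p).1 hbdd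
  have hbound : ∀ i, ‖p - T p‖ ^ 2 ≤
      ‖T (x i) - x i‖ ^ 2 + 2 * R * ‖T (x i) - x i‖ - 2 * inner ℝ (p - T p) (x i - p) := by
    intro i
    have hexpand : ‖x i - T p‖ ^ 2 =
        ‖x i - p‖ ^ 2 + 2 * inner ℝ (p - T p) (x i - p) + ‖p - T p‖ ^ 2 := by
      rw [← sub_add_sub_cancel (x i) p (T p), norm_add_sq_real, real_inner_comm]
    have htriangle : ‖x i - T p‖ ≤ ‖T (x i) - x i‖ + ‖x i - p‖ := by
      have hTxp : ‖T (x i) - T p‖ ≤ ‖x i - p‖ := by simpa using hT.norm_sub_le (hxC i) hp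
      have := norm_sub_le_norm_sub_add_norm_sub (x i) (T (x i)) (T p)
      rw [norm_sub_rev (x i) (T (x i))] at this
      linarith
    have hsq := pow_le_pow_left₀ (norm_nonneg _) htriangle 2
    nlinarith [mul_le_mul_of_nonneg_left (hR i) (norm_nonneg (T (x i) - x i))]
  have hlim : Tendsto (fun i => ‖T (x i) - x i‖ ^ 2 + 2 * R * ‖T (x i) - x i‖
      - 2 * inner ℝ (p - T p) (x i - p)) l (𝓝 0) := by
    have hinner := (tendsto_inner_of_tendsto_toWeakSpace hxp (p - T p)).sub_const
      (inner ℝ (p - T p) p)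
    simp only [← inner_sub_right, sub_self] at hinner
    simpa using ((hTx.norm.pow 2).add (hTx.norm.const_mul (2 * R))).sub (hinner.const_mul 2)
  have hzero : ‖p - T p‖ ^ 2 ≤ 0 := ge_of_tendsto' hlim hbound
  exact (sub_eq_zero.1 (norm_eq_zero.1 (pow_eq_zero_iff two_ne_zero |>.1
    (hzero.antisymm (sq_nonneg _))))).symm

theorem tendsto_of_norm_sub_sq_le [CompleteSpace H] {α : ℕ → ℝ} {x y : ℕ → H} {q v : H}
    {c c' M : ℝ} (hc : 0 < c) (hc' : 0 < c') (hM : 0 ≤ M) (hα0 : ∀ n, 0 ≤ α n)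
    (hα : Tendsto α atTop (𝓝 0)) (hα_sum : ¬Summable α) (hx : Bornology.IsBounded (Set.range x))
    (hyx : ∀ n, ‖y n - q‖ ≤ ‖x n - q‖)
    (hv : ∀ U : Ultrafilter ℕ, (U : Filter ℕ) ≤ atTop → Tendsto (fun n => x n - y n) U (𝓝 0) →
      ∀ p, Tendsto (fun n => toWeakSpace ℝ H (x n)) U (𝓝 (toWeakSpace ℝ H p)) →
        inner ℝ v (p - q) ≤ 0)
    (hstep : ∀ᶠ n in atTop, ‖x (n + 1) - q‖ ^ 2 ≤ (1 - c * α n) * ‖x n - q‖ ^ 2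
      + α n * (2 * inner ℝ v (x n - q) + 2 * M * ‖x n - y n‖ + α n * M ^ 2)
      - c' * ‖x n - y n‖ ^ 2) :
    Tendsto x atTop (𝓝 q) := by
  obtain ⟨R, hR⟩ := (isBounded_range_iff_norm_sub_le q).1 hx
  obtain ⟨K, hK⟩ := hα.bddAbove_range
  have hsq : Tendsto (fun n => ‖x n - q‖ ^ 2) atTop (𝓝 0) := by
    refine tendsto_zero_of_le_one_sub_mul_add_sub hc (fun n => sq_nonneg _) hα0 hα hα_sum
      (fun n => mul_nonneg hc'.le (sq_nonneg _)) ?_ (fun U hU hη ε hε => ?_) hstep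
    · refine ⟨2 * (‖v‖ * R) + 2 * M * (2 * R) + K * M ^ 2, Set.forall_mem_range.2 fun n => ?_⟩
      have hxy : ‖x n - y n‖ ≤ 2 * R := by
        linarith [norm_sub_le_norm_sub_add_norm_sub (x n) q (y n), hR n, hyx n,
          norm_sub_rev q (y n)]
      gcongr
      · exact (real_inner_le_norm _ _).trans (by gcongr; exact hR n)
      · exact hK (Set.mem_range_self n)
    · have hxy : Tendsto (fun n => ‖x n - y n‖) U (𝓝 0) := by
        simpa [hc'.ne'] using (hη.const_mul c'⁻¹).sqrt
      have hrest : Tendsto (fun n => 2 * M * ‖x n - y n‖ + α n * M ^ 2) U (𝓝 0) := by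
        simpa using (hxy.const_mul (2 * M)).add ((hα.mono_left hU).mul_const (M ^ 2))
      filter_upwards [hrest.eventually_lt_const (half_pos hε),
        eventually_inner_sub_lt_of_tendsto_toWeakSpace U hx
          (hv U hU (tendsto_zero_iff_norm_tendsto_zero.2 hxy)) (half_pos (half_pos hε))]
        with n hrestn hinnern
      linarith
  refine tendsto_iff_norm_sub_tendsto_zero.2 ?_
  simpa using hsq.sqrt

end WeakTopology

section FixedPoints

variable {E : Type*} [NormedAddCommGroup E] {C : Set E}

theorem convex_setOf_mem_and_eq [NormedSpace ℝ E] [StrictConvexSpace ℝ E] {T : E → E}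
    (hC : Convex ℝ C) (hT : LipschitzOnWith 1 T C) : Convex ℝ {p | p ∈ C ∧ T p = p} := by
  rw [convex_iff_segment_subset]
  rintro u ⟨huC, hu⟩ v ⟨hvC, hv⟩ w hw
  have hwC : w ∈ C := hC.segment_subset huC hvC hw
  rw [segment_eq_image_lineMap] at hw
  obtain ⟨r, ⟨hr0, hr1⟩, rfl⟩ := hw
  set w := AffineMap.lineMap u v r
  have huw : dist u (T w) ≤ r * dist u v := by
    simpa [hu, w, abs_of_nonneg hr0] using hT.dist_le_mul u huC w hwC
  have hwv : dist (T w) v ≤ (1 - r) * dist u v := by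
    simpa [hv, w, abs_of_nonneg (sub_nonneg.2 hr1)] using hT.dist_le_mul w hwC v hvC
  have htriangle := dist_triangle u (T w) v
  exact ⟨hwC, eq_lineMap_of_dist_eq_mul_of_dist_eq_mul (huw.antisymm (by linarith))
    (hwv.antisymm (by linarith))⟩

variable {T : ℕ → E → E} (hT : ∀ i, 1 ≤ i → LipschitzOnWith 1 (T i) C)
include hT

theorem isClosed_commonFixedPoints (hC : IsClosed C) : IsClosed (commonFixedPoints C T) := by
  have hinter : commonFixedPoints C T = C ∩ ⋂ i, ⋂ (_ : 1 ≤ i), {p | p ∈ C ∧ T i p = p} := by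
    ext p
    simp +contextual [commonFixedPoints]
  rw [hinter]
  exact hC.inter (isClosed_iInter fun i => isClosed_iInter fun hi =>
    hC.isClosed_eq (hT i hi).continuousOn continuousOn_id)

theorem convex_commonFixedPoints [NormedSpace ℝ E] [StrictConvexSpace ℝ E] (hC : Convex ℝ C) :
    Convex ℝ (commonFixedPoints C T) := by
  intro u hu v hv r s hr hs hrs
  exact ⟨hC hu.1 hv.1 hr hs hrs, fun i hi => (convex_setOf_mem_and_eq hC (hT i hi)
    ⟨hu.1, hu.2 i hi⟩ ⟨hv.1, hv.2 i hi⟩ hr hs hrs).2⟩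

end FixedPoints

theorem norm_sub_sq_sub_norm_sub_sq_le {E : Type*} [SeminormedAddCommGroup E] {p u w x : E}
    (hwu : ‖w - p‖ ≤ ‖u - p‖) (hux : ‖u - p‖ ≤ ‖x - p‖) :
    ‖x - p‖ ^ 2 - ‖u - p‖ ^ 2 ≤ 2 * ‖x - p‖ * ‖w - x‖ := by
  have htriangle : ‖x - p‖ - ‖u - p‖ ≤ ‖w - x‖ := by
    linarith [norm_sub_le_norm_sub_add_norm_sub x w p, norm_sub_rev x w]
  calc ‖x - p‖ ^ 2 - ‖u - p‖ ^ 2 = (‖x - p‖ + ‖u - p‖) * (‖x - p‖ - ‖u - p‖) := by ring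
    _ ≤ 2 * ‖x - p‖ * ‖w - x‖ := by
      gcongr
      linarith

section ConvexCombinations

variable {E H : Type*} [NormedAddCommGroup E] [NormedSpace ℝ E] [NormedAddCommGroup H]
  [InnerProductSpace ℝ H]

theorem norm_convexComb_le {t r : ℝ} (ht : t ∈ Set.Icc 0 1) {u v : E} (hu : ‖u‖ ≤ r)
    (hv : ‖v‖ ≤ r) : ‖t • u + (1 - t) • v‖ ≤ r :=
  mem_closedBall_zero_iff.1 <| convex_closedBall (0 : E) r (mem_closedBall_zero_iff.2 hu)
    (mem_closedBall_zero_iff.2 hv) ht.1 (sub_nonneg.2 ht.2) (add_sub_cancel t 1)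

theorem norm_convexComb_sub_le {t r : ℝ} (ht : t ∈ Set.Icc 0 1) {u v q : E} (hu : ‖u - q‖ ≤ r)
    (hv : ‖v - q‖ ≤ r) : ‖t • u + (1 - t) • v - q‖ ≤ r := by
  convert norm_convexComb_le ht hu hv using 2
  module

theorem norm_convexComb_sq (t : ℝ) (u v : H) :
    ‖t • u + (1 - t) • v‖ ^ 2 = t * ‖u‖ ^ 2 + (1 - t) * ‖v‖ ^ 2 - t * (1 - t) * ‖u - v‖ ^ 2 := by
  rw [norm_add_sq_real, norm_sub_sq_real, norm_smul, norm_smul, real_inner_smul_left,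
    real_inner_smul_right, mul_pow, mul_pow, Real.norm_eq_abs, Real.norm_eq_abs, sq_abs, sq_abs]
  ring

theorem mul_norm_convexComb_sub_sq_le {t : ℝ} (ht : 0 ≤ t) {p v x : H}
    (hv : ‖v - p‖ ≤ ‖x - p‖) :
    (1 - t) * ‖t • v + (1 - t) • x - x‖ ^ 2 ≤
      t * (‖x - p‖ ^ 2 - ‖t • v + (1 - t) • x - p‖ ^ 2) := by
  have hx : t • v + (1 - t) • x - x = t • (v - x) := by module
  have hp : t • v + (1 - t) • x - p = t • (v - p) + (1 - t) • (x - p) := by module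
  rw [hx, hp, norm_convexComb_sq, sub_sub_sub_cancel_right, norm_smul, Real.norm_of_nonneg ht]
  linarith [mul_le_mul_of_nonneg_left (pow_le_pow_left₀ (norm_nonneg _) hv 2) (mul_self_nonneg t)]

theorem norm_convexComb_add_smul_sq_le {s t : ℝ} (hs : s ∈ Set.Icc 0 1) (ht : 0 ≤ t) {u v : H}
    (hvu : ‖v‖ ≤ ‖u‖) (w : H) :
    ‖s • u + (1 - s) • v + t • w‖ ^ 2 ≤ ‖u‖ ^ 2 - s * (1 - s) * ‖u - v‖ ^ 2
      + t * (2 * inner ℝ w u + 2 * ‖w‖ * ‖u - v‖ + t * ‖w‖ ^ 2) := by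
  have hs' : 0 ≤ 1 - s := sub_nonneg.2 hs.2
  have hnorm : ‖s • u + (1 - s) • v‖ ^ 2 ≤ ‖u‖ ^ 2 - s * (1 - s) * ‖u - v‖ ^ 2 := by
    rw [norm_convexComb_sq]
    linarith [mul_le_mul_of_nonneg_left (pow_le_pow_left₀ (norm_nonneg v) hvu 2) hs']
  have hinner : inner ℝ (s • u + (1 - s) • v) w ≤ inner ℝ w u + ‖w‖ * ‖u - v‖ := by
    have hcomb : s • u + (1 - s) • v = u - (1 - s) • (u - v) := by module
    rw [real_inner_comm, hcomb, inner_sub_right, real_inner_smul_right]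
    have hlower := mul_le_mul_of_nonneg_left
      (neg_le_of_abs_le (abs_real_inner_le_norm w (u - v))) hs'
    linarith [mul_nonneg hs.1 (mul_nonneg (norm_nonneg w) (norm_nonneg (u - v)))]
  rw [norm_add_sq_real, real_inner_smul_right, norm_smul, Real.norm_of_nonneg ht, mul_pow]
  linarith [mul_le_mul_of_nonneg_left hinner ht]

end ConvexCombinations

section MetricProjection

variable {H : Type*} [NormedAddCommGroup H] [InnerProductSpace ℝ H] [CompleteSpace H] {C : Set H}
  (hclosed : IsClosed C) (hconvex : Convex ℝ C)
include hclosed hconvex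

theorem inner_sub_metricProj_nonpos (u : H) {w : H} (hw : w ∈ C) :
    inner ℝ (u - metricProj C u) (w - metricProj C u) ≤ 0 :=
  inner_nearest_nonpos hconvex (metricProj_mem ⟨w, hw⟩ hclosed hconvex u)
    (fun _ => metricProj_le ⟨w, hw⟩ hclosed hconvex u) w hw

theorem norm_metricProj_sub_metricProj_le (hne : C.Nonempty) (u v : H) :
    ‖metricProj C u - metricProj C v‖ ≤ ‖u - v‖ := by
  have hu := inner_sub_metricProj_nonpos hclosed hconvex u (metricProj_mem hne hclosed hconvex v)
  have hv := inner_sub_metricProj_nonpos hclosed hconvex v (metricProj_mem hne hclosed hconvex u)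
  set p := metricProj C u
  set q := metricProj C v
  have hsplit : ‖p - q‖ ^ 2 =
      inner ℝ (u - v) (p - q) + inner ℝ (u - p) (q - p) + inner ℝ (v - q) (p - q) := by
    rw [← real_inner_self_eq_norm_sq, ← neg_sub p q, inner_neg_right, ← sub_eq_add_neg,
      ← inner_sub_left, ← inner_add_left]
    congr 1
    abel
  have hsq : ‖p - q‖ * ‖p - q‖ ≤ ‖u - v‖ * ‖p - q‖ := by
    linarith [real_inner_le_norm (u - v) (p - q), sq ‖p - q‖]
  rcases (norm_nonneg (p - q)).eq_or_lt with h | h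
  · exact h ▸ norm_nonneg _
  · exact le_of_mul_le_mul_right hsq h

theorem norm_metricProj_sub_le (u : H) {p : H} (hp : p ∈ C) :
    ‖metricProj C u - p‖ ≤ ‖u - p‖ := by
  have hfix : p = metricProj C p := eq_metricProj hclosed hconvex hp fun w _ => by simp
  simpa [← hfix] using norm_metricProj_sub_metricProj_le hclosed hconvex ⟨p, hp⟩ u p

end MetricProjection

section StronglyPositive

variable {H : Type*} [NormedAddCommGroup H] [InnerProductSpace ℝ H] {A : H →L[ℝ] H} {κ : ℝ}
  (hA : ∀ x : H, κ * ‖x‖ ^ 2 ≤ inner ℝ (A x) x)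
include hA

theorem norm_smul_sub_smul_apply_le {r t ρ : ℝ} (hr : 0 ≤ r) (ht : 0 ≤ t) (htρ : t * ρ ≤ r)
    (htA : t * ‖A‖ ^ 2 ≤ 2 * r * (κ - ρ)) (h : H) :
    ‖r • h - t • A h‖ ≤ (r - t * ρ) * ‖h‖ := by
  refine le_of_sq_le_sq ?_ (mul_nonneg (sub_nonneg.2 htρ) (norm_nonneg h))
  have hAh : ‖A h‖ ^ 2 ≤ ‖A‖ ^ 2 * ‖h‖ ^ 2 := by
    rw [← mul_pow]
    exact pow_le_pow_left₀ (norm_nonneg _) (A.le_opNorm h) 2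
  calc ‖r • h - t • A h‖ ^ 2
      = r ^ 2 * ‖h‖ ^ 2 - 2 * (r * t) * inner ℝ (A h) h + t ^ 2 * ‖A h‖ ^ 2 := by
        rw [norm_sub_sq_real, norm_smul, norm_smul, real_inner_smul_left, real_inner_smul_right,
          real_inner_comm, Real.norm_of_nonneg hr, Real.norm_of_nonneg ht]
        ring
    _ ≤ r ^ 2 * ‖h‖ ^ 2 - 2 * (r * t) * (κ * ‖h‖ ^ 2) + t ^ 2 * (‖A‖ ^ 2 * ‖h‖ ^ 2) := by
        gcongr
        exact hA h
    _ ≤ ((r - t * ρ) * ‖h‖) ^ 2 := by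
        linarith [mul_le_mul_of_nonneg_left htA (mul_nonneg ht (sq_nonneg ‖h‖)),
          sq_nonneg (t * ρ * ‖h‖)]

theorem eventually_norm_smul_sub_smul_apply_le {ρ r₀ : ℝ} (hρ : ρ < κ) (hr₀ : 0 < r₀) :
    ∀ᶠ t in 𝓝[≥] 0, ∀ r ≥ r₀, t * ρ ≤ r ∧ ∀ h, ‖r • h - t • A h‖ ≤ (r - t * ρ) * ‖h‖ := by
  have hsmall : ∀ K : ℝ, ∀ b > 0, ∀ᶠ t in 𝓝[≥] (0 : ℝ), t * K ≤ b := fun K b hb =>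
    tendsto_nhdsWithin_of_tendsto_nhds (f := fun t : ℝ => t * K)
      (by simpa using (tendsto_id (x := 𝓝 (0 : ℝ))).mul_const K) |>.eventually_le_const hb
  filter_upwards [self_mem_nhdsWithin, hsmall ρ r₀ hr₀, hsmall (‖A‖ ^ 2) (2 * r₀ * (κ - ρ))
    (mul_pos (mul_pos two_pos hr₀) (sub_pos.2 hρ))] with t ht htρ htA r hr
  refine ⟨htρ.trans hr, norm_smul_sub_smul_apply_le hA (hr₀.le.trans hr) ht (htρ.trans hr) ?_⟩
  exact htA.trans (mul_le_mul_of_nonneg_right (by linarith) (sub_pos.2 hρ).le)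

theorem mul_norm_sub_sq_le_inner_sub {g : H → H} {L : ℝ} {u v : H}
    (hg : ‖g u - g v‖ ≤ L * ‖u - v‖) :
    (κ - L) * ‖u - v‖ ^ 2 ≤ inner ℝ (A u - g u - (A v - g v)) (u - v) := by
  have hsplit : A u - g u - (A v - g v) = A (u - v) - (g u - g v) := by
    rw [map_sub]
    abel
  have hginner := (real_inner_le_norm (g u - g v) (u - v)).trans
    (mul_le_mul_of_nonneg_right hg (norm_nonneg _))
  rw [hsplit, inner_sub_left]
  linarith [hA (u - v)]

end StronglyPositive

section Viscosity

variable {H : Type*} [NormedAddCommGroup H] [InnerProductSpace ℝ H]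

/-- The point `t g(x) + s x + ((1 - s) I - t A) y` that one step of the general viscosity iteration
projects onto the constraint set. -/
def viscosityPoint (g : H → H) (A : H →L[ℝ] H) (t s : ℝ) (x y : H) : H :=
  t • g x + s • x + ((1 - s) • y - t • A y)

variable {g : H → H} {A : H →L[ℝ] H} {κ L : ℝ}

theorem viscosityPoint_self_sub (t s : ℝ) (q : H) :
    viscosityPoint g A t s q q - q = t • (g q - A q) := by
  unfold viscosityPoint
  module

theorem viscosityPoint_sub (t s : ℝ) (x y q : H) :
    viscosityPoint g A t s x y - q = s • (x - q) + (1 - s) • (y - q) + t • (g x - A y) := by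
  unfold viscosityPoint
  module

theorem norm_sub_apply_le {x y q : H} (hg : ‖g x - g q‖ ≤ L * ‖x - q‖)
    (hyx : ‖y - q‖ ≤ ‖x - q‖) : ‖g x - A y‖ ≤ ‖g q - A q‖ + (L + ‖A‖) * ‖x - q‖ := by
  have hsplit : g x - A y = g q - A q + (g x - g q) - A (y - q) := by
    rw [map_sub]
    abel
  have hAyq : ‖A (y - q)‖ ≤ ‖A‖ * ‖x - q‖ := (A.le_opNorm _).trans (by gcongr)
  rw [hsplit]
  linarith [norm_sub_le (g q - A q + (g x - g q)) (A (y - q)),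
    norm_add_le (g q - A q) (g x - g q)]

section StronglyPositive

variable (hA : ∀ x : H, κ * ‖x‖ ^ 2 ≤ inner ℝ (A x) x)
include hA

theorem eventually_norm_viscosityPoint_sub_le {ρ c : ℝ} (hρ : ρ < κ) (hc : c < 1) :
    ∀ᶠ t in 𝓝[≥] 0, ∀ s ∈ Set.Icc 0 c, ∀ x x' y y' : H, ‖g x - g x'‖ ≤ L * ‖x - x'‖ →
      ‖y - y'‖ ≤ ‖x - x'‖ → ‖viscosityPoint g A t s x y - viscosityPoint g A t s x' y'‖ ≤
        (1 - t * (ρ - L)) * ‖x - x'‖ := by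
  filter_upwards [self_mem_nhdsWithin,
    eventually_norm_smul_sub_smul_apply_le hA hρ (sub_pos.2 hc)] with t ht hcontr
  rintro s ⟨hs0, hsc⟩ x x' y y' hg hy
  obtain ⟨htρ, hcontr⟩ := hcontr (1 - s) (by linarith)
  have hsplit : viscosityPoint g A t s x y - viscosityPoint g A t s x' y' =
      t • (g x - g x') + s • (x - x') + ((1 - s) • (y - y') - t • A (y - y')) := by
    rw [map_sub, viscosityPoint, viscosityPoint]
    module
  calc ‖viscosityPoint g A t s x y - viscosityPoint g A t s x' y'‖
      ≤ t * ‖g x - g x'‖ + s * ‖x - x'‖ + ‖(1 - s) • (y - y') - t • A (y - y')‖ := by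
        rw [hsplit]
        refine norm_add₃_le.trans_eq ?_
        rw [norm_smul, norm_smul, Real.norm_of_nonneg ht, Real.norm_of_nonneg hs0]
    _ ≤ t * (L * ‖x - x'‖) + s * ‖x - x'‖ + (1 - s - t * ρ) * ‖x - x'‖ := by
        have := sub_nonneg.2 htρ
        exact add_le_add (add_le_add_left (mul_le_mul_of_nonneg_left hg ht) _)
          ((hcontr _).trans (mul_le_mul_of_nonneg_left hy this))
    _ = (1 - t * (ρ - L)) * ‖x - x'‖ := by ring

theorem existsUnique_inner_sub_nonpos [CompleteSpace H] {F : Set H} (hne : F.Nonempty)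
    (hclosed : IsClosed F) (hconvex : Convex ℝ F) {L : NNReal} (hg : LipschitzOnWith L g F)
    (hL : L < κ) : ∃! q, q ∈ F ∧ ∀ p ∈ F, inner ℝ (g q - A q) (p - q) ≤ 0 := by
  obtain ⟨ρ, hLρ, hρκ⟩ := exists_between hL
  have hpos : ∀ᶠ t in 𝓝[>] (0 : ℝ), 0 < t := self_mem_nhdsWithin
  obtain ⟨t, ht, hcontr⟩ := (hpos.and ((eventually_norm_viscosityPoint_sub_le (g := g) (L := L)
    hA hρκ one_pos).filter_mono (nhdsWithin_mono 0 Set.Ioi_subset_Ici_self))).exists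
  set Φ : H → H := fun u => metricProj F (viscosityPoint g A t 0 u u)
  have hΦF : Set.MapsTo Φ F F := fun u _ => metricProj_mem hne hclosed hconvex _
  have hΦ : ContractingWith (1 - t * (ρ - L)).toNNReal (hΦF.restrict Φ F F) := by
    refine ⟨Real.toNNReal_lt_one.2 (by linarith [mul_pos ht (sub_pos.2 hLρ)]),
      LipschitzWith.of_dist_le' fun u v => ?_⟩
    rw [Subtype.dist_eq, Subtype.dist_eq, dist_eq_norm, dist_eq_norm]
    exact (norm_metricProj_sub_metricProj_le hclosed hconvex hne _ _).trans
      (hcontr 0 (by simp) u v u v (hg.norm_sub_le u.2 v.2) le_rfl)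
  obtain ⟨u, hu⟩ := hne
  obtain ⟨q, hqF, hq, -⟩ := hΦ.exists_fixedPoint' hclosed.isComplete hΦF hu (edist_ne_top _ _)
  have hVI : ∀ p ∈ F, inner ℝ (g q - A q) (p - q) ≤ 0 := by
    intro p hp
    have hinner := inner_sub_metricProj_nonpos hclosed hconvex (viscosityPoint g A t 0 q q) hp
    rw [show metricProj F (viscosityPoint g A t 0 q q) = q from hq, viscosityPoint_self_sub,
      real_inner_smul_left] at hinner
    exact nonpos_of_mul_nonpos_right hinner ht
  refine ⟨q, ⟨hqF, hVI⟩, fun q' ⟨hq'F, hq'⟩ => ?_⟩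
  have hVI' := hq' q hqF
  rw [← neg_sub q' q, inner_neg_right, ← inner_neg_left, neg_sub] at hVI'
  have hmono := mul_norm_sub_sq_le_inner_sub hA (hg.norm_sub_le hq'F hqF)
  rw [inner_sub_left, ← neg_sub (g q), inner_neg_left] at hmono
  have hsq : (κ - L) * ‖q' - q‖ ^ 2 ≤ 0 := by linarith [hVI q' hq'F]
  exact sub_eq_zero.1 (norm_eq_zero.1 (pow_eq_zero_iff two_ne_zero |>.1
    ((nonpos_of_mul_nonpos_right hsq (sub_pos.2 hL)).antisymm (sq_nonneg _))))

theorem isBounded_range_of_norm_sub_le_viscosityPoint {α δ : ℕ → ℝ} {x y : ℕ → H} {q : H}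
    {c : ℝ} (hL : L < κ) (hc : c < 1) (hα0 : ∀ n, 0 ≤ α n)
    (hα : Tendsto α atTop (𝓝 0)) (hδ : ∀ᶠ n in atTop, δ n ∈ Set.Icc 0 c)
    (hg : ∀ n, ‖g (x n) - g q‖ ≤ L * ‖x n - q‖) (hyx : ∀ n, ‖y n - q‖ ≤ ‖x n - q‖)
    (hstep : ∀ n, ‖x (n + 1) - q‖ ≤ ‖viscosityPoint g A (α n) (δ n) (x n) (y n) - q‖) :
    Bornology.IsBounded (Set.range x) := by
  obtain ⟨ρ, hLρ, hρκ⟩ := exists_between hL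
  have hρL : 0 < ρ - L := sub_pos.2 hLρ
  have hα' : Tendsto α atTop (𝓝[≥] 0) := tendsto_nhdsWithin_iff.2 ⟨hα, .of_forall hα0⟩
  suffices h : BddAbove (Set.range fun n => ‖x n - q‖) from
    (isBounded_range_iff_norm_sub_le q).2 (h.imp fun _ => Set.forall_mem_range.1)
  refine bddAbove_range_of_le_convexComb (a := fun n => α n * (ρ - L))
    (B := ‖g q - A q‖ / (ρ - L)) ?_ ?_
  · have hlim : Tendsto (fun n => α n * (ρ - L)) atTop (𝓝 0) := by
      simpa using hα.mul_const (ρ - L)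
    filter_upwards [hlim.eventually_le_const one_pos] with n hn
    exact ⟨mul_nonneg (hα0 n) hρL.le, hn⟩
  · filter_upwards [hδ, hα'.eventually
      (eventually_norm_viscosityPoint_sub_le (g := g) (L := L) hA hρκ hc)] with n hδn hcontr
    have htriangle := norm_sub_le_norm_sub_add_norm_sub
      (viscosityPoint g A (α n) (δ n) (x n) (y n)) (viscosityPoint g A (α n) (δ n) q q) q
    rw [viscosityPoint_self_sub, norm_smul, Real.norm_of_nonneg (hα0 n)] at htriangle
    rw [mul_assoc, mul_div_cancel₀ _ hρL.ne']
    exact ((hstep n).trans htriangle).trans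
      (add_le_add_left (hcontr _ hδn _ _ _ _ (hg n) (hyx n)) _)

theorem inner_sub_apply_le {x y q : H} (hg : ‖g x - g q‖ ≤ L * ‖x - q‖) :
    inner ℝ (g x - A y) (x - q) ≤
      inner ℝ (g q - A q) (x - q) - (κ - L) * ‖x - q‖ ^ 2 + ‖A‖ * ‖x - q‖ * ‖x - y‖ := by
  have hsplit : g x - A y = g q - A q - (A x - g x - (A q - g q)) + A (x - y) := by
    rw [map_sub]
    abel
  have hAxy : inner ℝ (A (x - y)) (x - q) ≤ ‖A‖ * ‖x - y‖ * ‖x - q‖ :=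
    (real_inner_le_norm _ _).trans (mul_le_mul_of_nonneg_right (A.le_opNorm _) (norm_nonneg _))
  rw [hsplit, inner_add_left, inner_sub_left _ (A x - g x - (A q - g q))]
  linarith [mul_norm_sub_sq_le_inner_sub hA hg]

theorem norm_viscosityPoint_sub_sq_le {t s M : ℝ} (ht : 0 ≤ t) (hs : s ∈ Set.Icc 0 1) {x y q : H}
    (hg : ‖g x - g q‖ ≤ L * ‖x - q‖) (hyx : ‖y - q‖ ≤ ‖x - q‖)
    (hM : ‖A‖ * ‖x - q‖ + ‖g x - A y‖ ≤ M) :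
    ‖viscosityPoint g A t s x y - q‖ ^ 2 ≤ (1 - 2 * (κ - L) * t) * ‖x - q‖ ^ 2
      + t * (2 * inner ℝ (g q - A q) (x - q) + 2 * M * ‖x - y‖ + t * M ^ 2)
      - s * (1 - s) * ‖x - y‖ ^ 2 := by
  have hAx : 0 ≤ ‖A‖ * ‖x - q‖ := by positivity
  have hwM : t * ‖g x - A y‖ ^ 2 ≤ t * M ^ 2 := by
    gcongr
    linarith
  have hcross : inner ℝ (g x - A y) (x - q) + ‖g x - A y‖ * ‖x - y‖ ≤
      inner ℝ (g q - A q) (x - q) - (κ - L) * ‖x - q‖ ^ 2 + M * ‖x - y‖ := by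
    linarith [inner_sub_apply_le (y := y) hA hg,
      mul_le_mul_of_nonneg_right hM (norm_nonneg (x - y))]
  have hsq := norm_convexComb_add_smul_sq_le hs ht hyx (g x - A y)
  rw [sub_sub_sub_cancel_right, ← viscosityPoint_sub] at hsq
  linarith [mul_le_mul_of_nonneg_left hcross ht, mul_le_mul_of_nonneg_left hwM ht]

theorem tendsto_of_norm_sub_le_viscosityPoint [CompleteSpace H] {F : Set H} {L : NNReal}
    {α δ : ℕ → ℝ} {x y : ℕ → H} {q : H} {c₁ c₂ : ℝ} (hL : L < κ)
    (hq : ∀ p ∈ F, inner ℝ (g q - A q) (p - q) ≤ 0) (hα0 : ∀ n, 0 ≤ α n)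
    (hα : Tendsto α atTop (𝓝 0)) (hα_sum : ¬Summable α) (hc₁ : 0 < c₁) (hc₂ : c₂ < 1)
    (hδ : ∀ᶠ n in atTop, δ n ∈ Set.Icc c₁ c₂)
    (hg : ∀ n, ‖g (x n) - g q‖ ≤ L * ‖x n - q‖) (hyx : ∀ n, ‖y n - q‖ ≤ ‖x n - q‖)
    (hstep : ∀ n, ‖x (n + 1) - q‖ ≤ ‖viscosityPoint g A (α n) (δ n) (x n) (y n) - q‖)
    (hF : Bornology.IsBounded (Set.range x) → ∀ U : Ultrafilter ℕ, (U : Filter ℕ) ≤ atTop →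
      Tendsto (fun n => x n - y n) U (𝓝 0) →
      ∀ p, Tendsto (fun n => toWeakSpace ℝ H (x n)) U (𝓝 (toWeakSpace ℝ H p)) → p ∈ F) :
    Tendsto x atTop (𝓝 q) := by
  have hx := isBounded_range_of_norm_sub_le_viscosityPoint hA hL hc₂ hα0 hα
    (hδ.mono fun n hn => ⟨hc₁.le.trans hn.1, hn.2⟩) hg hyx hstep
  obtain ⟨R, hR⟩ := (isBounded_range_iff_norm_sub_le q).1 hx
  set M := ‖A‖ * R + (‖g q - A q‖ + (L + ‖A‖) * R)
  have hM : ∀ n, ‖A‖ * ‖x n - q‖ + ‖g (x n) - A (y n)‖ ≤ M := fun n =>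
    add_le_add (by gcongr; exact hR n)
      ((norm_sub_apply_le (hg n) (hyx n)).trans (by gcongr; exact hR n))
  refine tendsto_of_norm_sub_sq_le (mul_pos two_pos (sub_pos.2 hL))
    (mul_pos hc₁ (sub_pos.2 hc₂)) (le_trans (by positivity) (hM 0)) hα0 hα hα_sum hx hyx
    (fun U hU hxy p hp => hq p (hF hx U hU hxy p hp)) ?_
  filter_upwards [hδ] with n hn
  have hδn : c₁ * (1 - c₂) ≤ δ n * (1 - δ n) :=
    mul_le_mul hn.1 (by linarith [hn.2]) (sub_pos.2 hc₂).le (hc₁.le.trans hn.1)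
  calc ‖x (n + 1) - q‖ ^ 2 ≤ ‖viscosityPoint g A (α n) (δ n) (x n) (y n) - q‖ ^ 2 :=
        pow_le_pow_left₀ (norm_nonneg _) (hstep n) 2
    _ ≤ _ := norm_viscosityPoint_sub_sq_le hA (hα0 n) ⟨hc₁.le.trans hn.1, hn.2.trans hc₂.le⟩
        (hg n) (hyx n) (hM n)
    _ ≤ _ := by gcongr

end StronglyPositive

end Viscosity

section ShimojiMaps

variable {E : Type*} [NormedAddCommGroup E] [NormedSpace ℝ E] {C : Set E} {T : ℕ → E → E}
  {θ : ℕ → ℝ} {k n : ℕ}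

theorem mapsTo_shimojiAux (hC : Convex ℝ C) (hTC : ∀ i, 1 ≤ i → Set.MapsTo (T i) C C)
    (hθ : ∀ i, 1 ≤ i → θ i ∈ Set.Icc 0 1) (m : ℕ) (hk : 1 ≤ k) :
    Set.MapsTo (shimojiAux T θ m k) C C := by
  induction m generalizing k with
  | zero => exact Set.mapsTo_id C
  | succ m ih =>
    exact fun x hx => hC (hTC k hk (ih k.succ_pos hx)) hx (hθ k hk).1 (sub_nonneg.2 (hθ k hk).2)
      (add_sub_cancel _ _)

theorem lipschitzOnWith_shimojiAux (hC : Convex ℝ C) (hTC : ∀ i, 1 ≤ i → Set.MapsTo (T i) C C)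
    (hT : ∀ i, 1 ≤ i → LipschitzOnWith 1 (T i) C) (hθ : ∀ i, 1 ≤ i → θ i ∈ Set.Icc 0 1) (m : ℕ)
    (hk : 1 ≤ k) : LipschitzOnWith 1 (shimojiAux T θ m k) C := by
  induction m generalizing k with
  | zero => exact LipschitzWith.id.lipschitzOnWith
  | succ m ih =>
    refine lipschitzOnWith_iff_norm_sub_le.2 fun x hx y hy => ?_
    have hT_aux := ((hT k hk).comp (ih k.succ_pos)
      (mapsTo_shimojiAux hC hTC hθ m k.succ_pos)).norm_sub_le hx hy
    rw [mul_one, NNReal.coe_one, one_mul] at hT_aux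
    rw [NNReal.coe_one, one_mul]
    have hsplit : shimojiAux T θ (m + 1) k x - shimojiAux T θ (m + 1) k y =
        θ k • (T k (shimojiAux T θ m (k + 1) x) - T k (shimojiAux T θ m (k + 1) y))
          + (1 - θ k) • (x - y) := by
      rw [shimojiAux, shimojiAux]
      module
    rw [hsplit]
    exact norm_convexComb_le (hθ k hk) hT_aux le_rfl

theorem shimojiAux_eq_of_mem_commonFixedPoints {p : E} (hp : p ∈ commonFixedPoints C T) (m : ℕ)
    (hk : 1 ≤ k) : shimojiAux T θ m k p = p := by
  induction m generalizing k with
  | zero => rfl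
  | succ m ih =>
    rw [shimojiAux, ih k.succ_pos, hp.2 k hk]
    module

theorem shimojiU_sub_self (hkn : k ≤ n) (x : E) :
    shimojiU T θ n k x - x = θ k • (T k (shimojiU T θ n (k + 1) x) - x) := by
  rw [shimojiU_of_le T θ hkn]
  module

section Hilbert

variable {H : Type*} [NormedAddCommGroup H] [InnerProductSpace ℝ H] {C : Set H} {T : ℕ → H → H}
  {p x : H}

variable (hC : Convex ℝ C) (hTC : ∀ i, 1 ≤ i → Set.MapsTo (T i) C C)
  (hT : ∀ i, 1 ≤ i → LipschitzOnWith 1 (T i) C)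
include hC hTC hT

/- `U_{n,k+1} x` is an average of `x` with a point at least as close to `p`, and `T_k` fixes `p`, so
displacing `U_{n,k+1} x` from `x` costs distance to `p`, hence displaces `T_k U_{n,k+1} x`. -/
theorem norm_shimojiU_succ_sub_sq_le (hθ : ∀ i, 1 ≤ i → θ i ∈ Set.Icc 0 1) (hk : 1 ≤ k)
    (hkn : k < n) (hp : p ∈ commonFixedPoints C T) (hx : x ∈ C) :
    θ k * (1 - θ (k + 1)) * ‖shimojiU T θ n (k + 1) x - x‖ ^ 2 ≤
      2 * θ (k + 1) * ‖x - p‖ * ‖shimojiU T θ n k x - x‖ := by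
  have hUC : ∀ j, 1 ≤ j → shimojiU T θ n j x ∈ C := fun j hj =>
    mapsTo_shimojiAux hC hTC hθ _ hj hx
  have hUp : ∀ j, 1 ≤ j → ‖shimojiU T θ n j x - p‖ ≤ ‖x - p‖ := fun j hj => by
    simpa [shimojiU, shimojiAux_eq_of_mem_commonFixedPoints hp _ hj] using
      (lipschitzOnWith_shimojiAux hC hTC hT hθ (n + 1 - j) hj).norm_sub_le hx hp.1
  have hTp : ∀ j, 1 ≤ j → ∀ u ∈ C, ‖T j u - p‖ ≤ ‖u - p‖ := fun j hj u hu => by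
    simpa [hp.2 j hj] using (hT j hj).norm_sub_le hu hp.1
  have hdecrease : (1 - θ (k + 1)) * ‖shimojiU T θ n (k + 1) x - x‖ ^ 2 ≤
      θ (k + 1) * (‖x - p‖ ^ 2 - ‖shimojiU T θ n (k + 1) x - p‖ ^ 2) := by
    rw [shimojiU_of_le T θ hkn]
    exact mul_norm_convexComb_sub_sq_le (hθ _ k.succ_pos).1
      ((hTp _ k.succ_pos _ (hUC _ (k + 1).succ_pos)).trans (hUp _ (k + 1).succ_pos))
  have hθk : 0 ≤ θ k := (hθ k hk).1
  have hθk' : 0 ≤ θ (k + 1) := (hθ _ k.succ_pos).1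
  calc θ k * (1 - θ (k + 1)) * ‖shimojiU T θ n (k + 1) x - x‖ ^ 2
      ≤ θ k * (θ (k + 1) * (‖x - p‖ ^ 2 - ‖shimojiU T θ n (k + 1) x - p‖ ^ 2)) := by
        rw [mul_assoc]
        gcongr
    _ ≤ θ k * (θ (k + 1) * (2 * ‖x - p‖ * ‖T k (shimojiU T θ n (k + 1) x) - x‖)) := by
        gcongr
        exact norm_sub_sq_sub_norm_sub_sq_le (hTp k hk _ (hUC _ k.succ_pos)) (hUp _ k.succ_pos)
    _ = 2 * θ (k + 1) * ‖x - p‖ * ‖shimojiU T θ n k x - x‖ := by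
        rw [shimojiU_sub_self hkn.le, norm_smul, Real.norm_of_nonneg hθk]
        ring

variable (hθ : ∀ i, 1 ≤ i → θ i ∈ Set.Ioo 0 1) (hp : p ∈ commonFixedPoints C T) {x : ℕ → H}
  (hxC : ∀ n, x n ∈ C) (hx : Bornology.IsBounded (Set.range x)) {l : Filter ℕ} (hl : l ≤ atTop)
  (hW : Tendsto (fun n => shimojiW T θ n (x n) - x n) l (𝓝 0))
include hθ hp hxC hx hl hW

theorem tendsto_shimojiU_sub (hk : 1 ≤ k) :
    Tendsto (fun n => shimojiU T θ n k (x n) - x n) l (𝓝 0) := by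
  obtain ⟨R, hR⟩ := (isBounded_range_iff_norm_sub_le p).1 hx
  induction k, hk using Nat.le_induction with
  | base => exact hW
  | succ k hk ih =>
    set c := θ k * (1 - θ (k + 1))
    have hc : 0 < c := mul_pos (hθ k hk).1 (sub_pos.2 (hθ _ k.succ_pos).2)
    have hθk' : 0 ≤ θ (k + 1) := (hθ _ k.succ_pos).1.le
    have hlim : Tendsto (fun n => √(2 * θ (k + 1) * R * ‖shimojiU T θ n k (x n) - x n‖ / c)) l
        (𝓝 0) := by
      simpa using ((ih.norm.const_mul (2 * θ (k + 1) * R)).div_const c).sqrt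
    refine squeeze_zero_norm' ?_ hlim
    filter_upwards [hl (eventually_gt_atTop k)] with n hn
    refine Real.le_sqrt_of_sq_le ((le_div_iff₀' hc).2 ?_)
    refine (norm_shimojiU_succ_sub_sq_le hC hTC hT (fun i hi => Set.Ioo_subset_Icc_self (hθ i hi))
      hk hn hp (hxC n)).trans ?_
    gcongr
    exact hR n

theorem tendsto_sub_of_tendsto_shimojiW_sub (hk : 1 ≤ k) :
    Tendsto (fun n => T k (x n) - x n) l (𝓝 0) := by
  have hU : ∀ {j}, 1 ≤ j → Tendsto (fun n => shimojiU T θ n j (x n) - x n) l (𝓝 0) :=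
    tendsto_shimojiU_sub hC hTC hT hθ hp hxC hx hl hW
  have hθk := (hθ k hk).1
  have hlim : Tendsto (fun n => ‖shimojiU T θ n (k + 1) (x n) - x n‖
      + (θ k)⁻¹ * ‖shimojiU T θ n k (x n) - x n‖) l (𝓝 0) := by
    simpa using (hU k.succ_pos).norm.add ((hU hk).norm.const_mul (θ k)⁻¹)
  refine squeeze_zero_norm' ?_ hlim
  filter_upwards [hl (eventually_ge_atTop k)] with n hn
  have hUC : shimojiU T θ n (k + 1) (x n) ∈ C := mapsTo_shimojiAux hC hTC
    (fun i hi => Set.Ioo_subset_Icc_self (hθ i hi)) _ k.succ_pos (hxC n)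
  rw [shimojiU_sub_self hn, norm_smul, Real.norm_of_nonneg hθk.le, inv_mul_cancel_left₀ hθk.ne']
  refine (norm_sub_le_norm_sub_add_norm_sub _ (T k (shimojiU T θ n (k + 1) (x n))) _).trans ?_
  gcongr
  rw [norm_sub_rev (shimojiU T θ n (k + 1) (x n))]
  simpa using (hT k hk).norm_sub_le (hxC n) hUC

theorem mem_commonFixedPoints_of_tendsto_toWeakSpace [l.NeBot] (hclosed : IsClosed C) {u : H}
    (hxu : Tendsto (fun n => toWeakSpace ℝ H (x n)) l (𝓝 (toWeakSpace ℝ H u))) :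
    u ∈ commonFixedPoints C T := by
  have huC : u ∈ C := mem_of_tendsto_toWeakSpace hclosed hC (.of_forall hxC) hxu
  exact ⟨huC, fun i hi => eq_of_tendsto_toWeakSpace_of_tendsto_sub (hT i hi) hxC huC hx hxu
    (tendsto_sub_of_tendsto_shimojiW_sub hC hTC hT hθ hp hxC hx hl hW hi)⟩

end Hilbert

end ShimojiMaps

section Ishikawa

variable {E : Type*} [NormedAddCommGroup E] [NormedSpace ℝ E]

/-- One step `x ↦ b x + (1 - b) W (c x + (1 - c) W x)` of the Ishikawa iteration of `W`. -/
def ishikawaStep (W : E → E) (b c : ℝ) (x : E) : E :=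
  b • x + (1 - b) • W (c • x + (1 - c) • W x)

variable {C : Set E} {W : E → E} {b c : ℝ} {x : E} (hC : Convex ℝ C) (hWC : Set.MapsTo W C C)
  (hW : LipschitzOnWith 1 W C) (hc : c ∈ Set.Icc 0 1) (hx : x ∈ C)
include hC hWC hW hc hx

theorem norm_ishikawaStep_sub_le (hb : b ∈ Set.Icc 0 1) {q : E} (hq : q ∈ C) (hWq : W q = q) :
    ‖ishikawaStep W b c x - q‖ ≤ ‖x - q‖ := by
  have hWne : ∀ u ∈ C, ‖W u - q‖ ≤ ‖u - q‖ := fun u hu => by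
    simpa [hWq] using hW.norm_sub_le hu hq
  have hinner : c • x + (1 - c) • W x ∈ C :=
    hC hx (hWC hx) hc.1 (sub_nonneg.2 hc.2) (add_sub_cancel _ _)
  exact norm_convexComb_sub_le hb le_rfl
    ((hWne _ hinner).trans (norm_convexComb_sub_le hc le_rfl (hWne x hx)))

theorem mul_norm_sub_le_norm_sub_ishikawaStep (hb : b ≤ 1) :
    (1 - b) * c * ‖W x - x‖ ≤ ‖x - ishikawaStep W b c x‖ := by
  set z := c • x + (1 - c) • W x with hz
  have hzC : z ∈ C := hC hx (hWC hx) hc.1 (sub_nonneg.2 hc.2) (add_sub_cancel _ _)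
  have hWzx : ‖W x - W z‖ ≤ (1 - c) * ‖W x - x‖ := by
    have hxz : x - z = (1 - c) • (x - W x) := by
      rw [hz]
      module
    simpa [hxz, norm_smul, abs_of_nonneg (sub_nonneg.2 hc.2), norm_sub_rev x] using
      hW.norm_sub_le hx hzC
  have hxy : ‖x - ishikawaStep W b c x‖ = (1 - b) * ‖W z - x‖ := by
    have hsub : x - ishikawaStep W b c x = (1 - b) • (x - W z) := by
      rw [ishikawaStep]
      module
    rw [hsub, norm_smul, Real.norm_of_nonneg (sub_nonneg.2 hb), norm_sub_rev]
  rw [hxy, mul_assoc]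
  refine mul_le_mul_of_nonneg_left ?_ (sub_nonneg.2 hb)
  linarith [norm_sub_le_norm_sub_add_norm_sub (W x) (W z) x]

end Ishikawa

theorem mainTheorem1_general {H : Type*} [NormedAddCommGroup H] [InnerProductSpace ℝ H]
    [CompleteSpace H] {C : Set H} (hCclosed : IsClosed C) (hCconvex : Convex ℝ C) {g : H → H}
    {L : NNReal} (hg : LipschitzOnWith L g C) {A : H →L[ℝ] H} {κ : ℝ}
    (hA : ∀ x : H, κ * ‖x‖ ^ 2 ≤ inner ℝ (A x) x) (hL : L < κ) {T : ℕ → H → H}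
    (hTC : ∀ i, 1 ≤ i → Set.MapsTo (T i) C C) (hT : ∀ i, 1 ≤ i → LipschitzOnWith 1 (T i) C)
    (hF : (commonFixedPoints C T).Nonempty) {θ : ℕ → ℝ} (hθ : ∀ i, 1 ≤ i → θ i ∈ Set.Ioo 0 1)
    {α β γs δ : ℕ → ℝ} {d : ℝ} (hd : 0 < d) (hα0 : ∀ n, 0 ≤ α n)
    (hβ : ∀ n, β n ∈ Set.Icc 0 (1 - d)) (hγs : ∀ n, γs n ∈ Set.Icc d 1)
    (hδ : ∀ n, δ n ∈ Set.Icc 0 1) (hα : Tendsto α atTop (𝓝 0)) (hα_sum : ¬Summable α)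
    (hδ_liminf : 0 < liminf δ atTop) (hδ_limsup : limsup δ atTop < 1) {x y : ℕ → H}
    (hx0 : x 0 ∈ C) (hy : ∀ n, y n = ishikawaStep (shimojiW T θ n) (β n) (γs n) (x n))
    (hx : ∀ n, x (n + 1) = metricProj C (viscosityPoint g A (α n) (δ n) (x n) (y n))) :
    ∃ q ∈ commonFixedPoints C T,
      (∀ p ∈ commonFixedPoints C T, inner ℝ (g q - A q) (p - q) ≤ 0) ∧
      (∀ q' ∈ commonFixedPoints C T,
        (∀ p ∈ commonFixedPoints C T, inner ℝ (g q' - A q') (p - q') ≤ 0) → q' = q) ∧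
      Tendsto x atTop (𝓝 q) := by
  have hθ' : ∀ i, 1 ≤ i → θ i ∈ Set.Icc 0 1 := fun i hi => Set.Ioo_subset_Icc_self (hθ i hi)
  have hγs' : ∀ n, γs n ∈ Set.Icc 0 1 := fun n => ⟨hd.le.trans (hγs n).1, (hγs n).2⟩
  have hβ1 : ∀ n, β n ≤ 1 := fun n => (hβ n).2.trans (sub_le_self 1 hd.le)
  have hWC : ∀ n, Set.MapsTo (shimojiW T θ n) C C := fun n =>
    mapsTo_shimojiAux hCconvex hTC hθ' _ le_rfl
  have hW : ∀ n, LipschitzOnWith 1 (shimojiW T θ n) C := fun n =>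
    lipschitzOnWith_shimojiAux hCconvex hTC hT hθ' _ le_rfl
  have hxC : ∀ n, x n ∈ C := Nat.rec hx0 fun n _ =>
    hx n ▸ metricProj_mem ⟨_, hx0⟩ hCclosed hCconvex _
  obtain ⟨q, ⟨hqF, hq⟩, huniq⟩ := existsUnique_inner_sub_nonpos hA hF
    (isClosed_commonFixedPoints hT hCclosed) (convex_commonFixedPoints hT hCconvex)
    (hg.mono fun p hp => hp.1) hL
  obtain ⟨c₁, hc₁, c₂, hc₂, hδc⟩ :=
    exists_eventually_mem_Icc_of_lt_liminf_of_limsup_lt hδ hδ_liminf hδ_limsup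
  refine ⟨q, hqF, hq, fun q' hq'F hq' => huniq q' ⟨hq'F, hq'⟩,
    tendsto_of_norm_sub_le_viscosityPoint hA hL hq hα0 hα hα_sum hc₁ hc₂ hδc
      (fun n => hg.norm_sub_le (hxC n) hqF.1) (fun n => ?_)
      (fun n => hx n ▸ norm_metricProj_sub_le hCclosed hCconvex _ hqF.1)
      fun hxb U hU hxy p hp => ?_⟩
  · rw [hy]
    exact norm_ishikawaStep_sub_le hCconvex (hWC n) (hW n) (hγs' n) (hxC n) ⟨(hβ n).1, hβ1 n⟩
      hqF.1 (shimojiAux_eq_of_mem_commonFixedPoints hqF _ le_rfl)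
  · refine mem_commonFixedPoints_of_tendsto_toWeakSpace hCconvex hTC hT hθ hqF hxC hxb hU ?_
      hCclosed hp
    have hlim : Tendsto (fun n => ‖x n - y n‖ / (d * d)) U (𝓝 0) := by
      simpa using hxy.norm.div_const (d * d)
    refine squeeze_zero_norm (fun n => (le_div_iff₀' (mul_pos hd hd)).2 ?_) hlim
    rw [hy]
    refine le_trans ?_ (mul_norm_sub_le_norm_sub_ishikawaStep hCconvex (hWC n) (hW n) (hγs' n)
      (hxC n) (hβ1 n))
    have hβd : d ≤ 1 - β n := le_sub_comm.1 (hβ n).2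
    have hβ0 : 0 ≤ 1 - β n := hd.le.trans hβd
    gcongr
    exact (hγs n).1

theorem mainTheorem1 {H : Type*} [NormedAddCommGroup H] [InnerProductSpace ℝ H] [CompleteSpace H]
    (C : Set H) (hCclosed : IsClosed C) (hCconvex : Convex ℝ C)
    -- `f` is a contraction of `C` into itself with constant `a`
    (f : H → H) (hfC : Set.MapsTo f C C) (a : ℝ) (ha0 : 0 < a) (ha1 : a < 1)
    (hf : ∀ x ∈ C, ∀ y ∈ C, ‖f x - f y‖ ≤ a * ‖x - y‖)
    -- `A` is a strongly positive bounded linear operator with coefficient `γbar`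
    (A : H →L[ℝ] H) (γbar : ℝ) (hγbar : 0 < γbar)
    (hA : ∀ x : H, γbar * ‖x‖ ^ 2 ≤ inner ℝ (A x) x)
    (γ : ℝ) (hγ0 : 0 < γ) (hγ1 : γ < γbar / a)
    -- nonexpansive self-maps `T_1, T_2, …` of `C` with a common fixed point
    (T : ℕ → H → H) (hTC : ∀ i, 1 ≤ i → Set.MapsTo (T i) C C)
    (hT : ∀ i, 1 ≤ i → ∀ x ∈ C, ∀ y ∈ C, ‖T i x - T i y‖ ≤ ‖x - y‖)
    (hF : (commonFixedPoints C T).Nonempty)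
    -- the weights of the `W_n`-mappings
    (θ : ℕ → ℝ) (b : ℝ) (hb : b < 1) (hθ : ∀ i, 1 ≤ i → 0 < θ i ∧ θ i ≤ b)
    -- the parameters of the iteration (`γs n` is the parameter `γ_n`)
    (α β γs δ : ℕ → ℝ)
    (hα : ∀ n, α n ∈ Set.Icc (0 : ℝ) 1) (hβ : ∀ n, β n ∈ Set.Icc (0 : ℝ) 1)
    (hγs : ∀ n, γs n ∈ Set.Icc (0 : ℝ) 1) (hδ : ∀ n, δ n ∈ Set.Icc (0 : ℝ) 1)
    (hC1 : Tendsto α atTop (𝓝 0))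
    (hC1' : Tendsto (fun N => ∑ n ∈ Finset.Icc 1 N, α n) atTop atTop)
    (hC2 : 0 < liminf δ atTop) (hC2' : limsup δ atTop < 1)
    (hC3 : Summable fun n => |γs (n + 1) - γs n|)
    (hC4 : Summable fun n => |α (n + 1) - α n|)
    (hC5 : Summable fun n => |β (n + 1) - β n|)
    (d : ℝ) (hd0 : 0 < d) (hd1 : d < 1) (hC6 : ∀ n, d < (1 + β n) * γs n - 2 * β n)
    -- the iteration
    (x y z : ℕ → H) (hx0 : x 0 ∈ C)
    (hz : ∀ n, z n = γs n • x n + (1 - γs n) • shimojiW T θ n (x n))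
    (hy : ∀ n, y n = β n • x n + (1 - β n) • shimojiW T θ n (z n))
    (hx : ∀ n, x (n + 1) = metricProj C
      (α n • γ • f (x n) + δ n • x n + ((1 - δ n) • y n - α n • A (y n)))) :
    ∃ q ∈ commonFixedPoints C T,
      (∀ p ∈ commonFixedPoints C T, inner ℝ (γ • f q - A q) (p - q) ≤ 0) ∧
      (∀ q' ∈ commonFixedPoints C T,
        (∀ p ∈ commonFixedPoints C T, inner ℝ (γ • f q' - A q') (p - q') ≤ 0) → q' = q) ∧
      Tendsto x atTop (𝓝 q) := by
  have hg : LipschitzOnWith (γ * a).toNNReal (fun u => γ • f u) C :=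
    LipschitzOnWith.of_dist_le' fun u hu v hv => by
      rw [dist_eq_norm, dist_eq_norm, ← smul_sub, norm_smul, Real.norm_of_nonneg hγ0.le, mul_assoc]
      exact mul_le_mul_of_nonneg_left (hf u hu v hv) hγ0.le
  have hL : ((γ * a).toNNReal : ℝ) < γbar := by
    rw [Real.coe_toNNReal _ (mul_pos hγ0 ha0).le]
    exact (lt_div_iff₀ ha0).1 hγ1
  exact mainTheorem1_general hCclosed hCconvex hg hA hL hTC
    (fun i hi => lipschitzOnWith_iff_norm_sub_le.2 (by simpa using hT i hi)) hF
    (fun i hi => ⟨(hθ i hi).1, (hθ i hi).2.trans_lt hb⟩) hd0 (fun n => (hα n).1)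
    (fun n => ⟨(hβ n).1, by nlinarith [hC6 n, (hβ n).1, (hγs n).2]⟩)
    (fun n => ⟨by nlinarith [hC6 n, (hβ n).1, (hγs n).2], (hγs n).2⟩) hδ hC1
    (not_summable_of_tendsto_sum_Icc (fun n => (hα n).1) hC1') hC2 hC2' hx0
    (fun n => by rw [hy, hz, ishikawaStep]) hx
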